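/- Let $n \ge 2$, let $\Omega \subset \mathbb{R}^n$ be open, let $F \in W^{1,n}_{\mathrm{loc}}(\Omega;\mathbb{R}^n)$ (in particular, $F \in W^{1,n}(\Omega;\mathbb{R}^n)$ is allowed), with weak differential matrix $DF = (\partial F^i/\partial x_j)_{i,j}$ and Jacobian determinant $J_F = \det DF$. Let $\operatorname{adj}(DF)$ be the adjugate matrix, so that $DF\cdot\operatorname{adj}(DF) = J_F\, I_n$. Let $V:\mathbb{R}^n\to\mathbb{R}^n$ be a $C^1$ vector field whose derivative $DV$ is bounded on $\mathbb{R}^n$. Then $$\operatorname{div}\big(\operatorname{adj}(DF)\,(V\circ F)\big) = \big((\operatorname{div} V)\circ F\big)\, J_F$$ in $\Omega$ in the sense of distributions; that is, $\operatorname{adj}(DF)(V\circ F)$ and $((\operatorname{div}V)\circ F)J_F$ are locally integrable in $\Omega$, and for every $\varphi\in C_c^\infty(\Omega)$ $$\int_\Omega \big\langle \operatorname{adj}(DF(x))\,V(F(x)),\,\nabla\varphi(x)\big\rangle\,dx = -\int_\Omega (\operatorname{div}V)(F(x))\,J_F(x)\,\varphi(x)\,dx .$$ -/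

import Mathlib

open MeasureTheory TopologicalSpace
open scoped Distributions ENNReal

namespace Piola

/-- Euclidean space `ℝⁿ`. -/
abbrev Euc (n : ℕ) : Type := EuclideanSpace ℝ (Fin n)

/-- The `j`-th partial derivative `∂φ/∂xⱼ (x)` of a real function on `ℝⁿ`. -/
noncomputable def partialDeriv {n : ℕ} (j : Fin n) (φ : Euc n → ℝ) (x : Euc n) : ℝ :=
  fderiv ℝ φ x (EuclideanSpace.single j 1)

/-- The classical divergence `∑ᵢ ∂Vⁱ/∂yᵢ (y)` of a vector field on `ℝⁿ`. -/
noncomputable def divergence {n : ℕ} (V : Euc n → Euc n) (y : Euc n) : ℝ :=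
  ∑ i, partialDeriv i (fun z => V z i) y

/-- `f ∈ L^p_loc(Ω)`: `f` is in `L^p(K)` for every compact `K ⊆ Ω`. -/
def MemLpLoc {n : ℕ} {G : Type*} [NormedAddCommGroup G]
    (Ω : Opens (Euc n)) (p : ℝ≥0∞) (f : Euc n → G) : Prop :=
  ∀ K : Set (Euc n), IsCompact K → K ⊆ (Ω : Set (Euc n)) → MemLp f p (volume.restrict K)

/-- `g` is the weak `j`-th partial derivative of the scalar function `u` in `Ω`: both are locally
integrable in `Ω`, and `∫_Ω u ∂φ/∂xⱼ = - ∫_Ω g φ` for every `φ ∈ C_c^∞(Ω)`. -/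
def IsWeakPartialDeriv {n : ℕ} (Ω : Opens (Euc n)) (j : Fin n) (u g : Euc n → ℝ) : Prop :=
  LocallyIntegrableOn u (Ω : Set (Euc n)) ∧ LocallyIntegrableOn g (Ω : Set (Euc n)) ∧
    ∀ φ : 𝓓(Ω, ℝ), ∫ x in Ω, u x * partialDeriv j φ x = - ∫ x in Ω, g x * φ x

/-- `DF` is (a representative of) the weak differential matrix of `F` in `Ω`, with entries
`(DF)ᵢⱼ = ∂Fⁱ/∂xⱼ`. -/
def IsWeakJacobian {n : ℕ} (Ω : Opens (Euc n)) (F : Euc n → Euc n)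
    (DF : Euc n → Matrix (Fin n) (Fin n) ℝ) : Prop :=
  ∀ i j, IsWeakPartialDeriv Ω j (fun x => F x i) (fun x => DF x i j)

/-- The local Sobolev space `W^{1,p}_loc(Ω; ℝⁿ)` of maps: `F` is in `L^p_loc(Ω)` and has weak first
partial derivatives in `L^p_loc(Ω)`. Values of `F` outside `Ω` play no role. -/
def MemW1pLoc {n : ℕ} (Ω : Opens (Euc n)) (p : ℝ≥0∞) (F : Euc n → Euc n) : Prop :=
  MemLpLoc Ω p F ∧ ∃ DF : Euc n → Matrix (Fin n) (Fin n) ℝ,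
    IsWeakJacobian Ω F DF ∧ ∀ i j, MemLpLoc Ω p (fun x => DF x i j)

/-- `div W = g` in `Ω` in the sense of distributions: `W` and `g` are locally integrable in `Ω` (so
that they define distributions), and `∫_Ω ∑ⱼ Wʲ ∂φ/∂xⱼ = - ∫_Ω g φ` for every `φ ∈ C_c^∞(Ω)`. -/
def DistribDivEq {n : ℕ} (Ω : Opens (Euc n)) (W : Euc n → Euc n) (g : Euc n → ℝ) : Prop :=
  LocallyIntegrableOn W (Ω : Set (Euc n)) ∧ LocallyIntegrableOn g (Ω : Set (Euc n)) ∧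
    ∀ φ : 𝓓(Ω, ℝ), ∫ x in Ω, ∑ j, W x j * partialDeriv j φ x = - ∫ x in Ω, g x * φ x

end Piola

namespace Piola

/-! For a `C²` map the identity is pointwise. The `j`-th component of the field is the determinant
of the transposed differential with row `j` replaced by `V ∘ G`. In its divergence the terms with
second derivatives cancel in pairs, by symmetry of the Hessian against antisymmetry of the
determinant (`sum_det_update_update_eq_zero`), and the chain rule with Cramer's rule turns the rest
into `div V · det` (`sum_det_update_comp`).

For a Sobolev map, mollify `F` and `DF` together, cut off to a compact neighbourhood of the support
of the test function (`integral_mollified_piola`). Since `DV` is bounded, `V` grows linearly, so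
both integrands are continuous functions of the jet `(F, DF)` of growth `1 + ‖·‖ ^ n`, exactly what
`W^{1,n}_loc` integrates. Mollifications converge almost everywhere; by Jensen they are dominated by
the mollification of `‖jet‖ ^ n`, whose integral does not depend on the scale. Pratt's form of
dominated convergence then gives the limit (`tendsto_integral_comp_convolution`). -/

/-! ### The Piola identity for smooth maps. -/

theorem hasFDerivAt_det {ι E : Type*} [Fintype ι] [DecidableEq ι] [NormedAddCommGroup E]
    [NormedSpace ℝ E] {R : E → ι → ι → ℝ} {R' : E →L[ℝ] ι → ι → ℝ} {x : E}
    (hR : HasFDerivAt R R' x) :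
    ∃ D : E →L[ℝ] ℝ, HasFDerivAt (fun y => (Matrix.of (R y)).det) D x ∧
      ∀ h, D h = ∑ k, (Matrix.of (Function.update (R x) k (R' h k))).det := by
  let d : ContinuousMultilinearMap ℝ (fun _ : ι => ι → ℝ) ℝ :=
    { (Matrix.detRowAlternating (R := ℝ) (n := ι)).toMultilinearMap with
      cont := (continuous_id (X := Matrix ι ι ℝ)).matrix_det }
  refine ⟨(d.linearDeriv (R x)).comp R', (d.hasFDerivAt (R x)).comp x hR, fun h => ?_⟩
  rw [ContinuousLinearMap.comp_apply, ContinuousMultilinearMap.linearDeriv_apply]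
  rfl

/-- Exchanging rows `j` and `k` flips the sign of the determinant, so symmetry of `H` makes the `(j,
k)` and `(k, j)` terms cancel. In the application `H` holds the second derivatives of the map. -/
theorem sum_det_update_update_eq_zero {ι : Type*} [Fintype ι] [DecidableEq ι]
    (M : ι → ι → ℝ) (v : ι → ℝ) (H : ι → ι → ι → ℝ) (hH : ∀ j k, H j k = H k j) :
    ∑ j, ∑ k, (if k = j then 0 else
      (Matrix.of (Function.update (Function.update M j v) k (H j k))).det) = 0 := by
  have hanti : ∀ j k, (if k = j then 0 else
      (Matrix.of (Function.update (Function.update M j v) k (H j k))).det) =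
      -(if j = k then 0 else
      (Matrix.of (Function.update (Function.update M k v) j (H k j))).det) := by
    intro j k
    by_cases h : k = j
    · simp [h]
    rw [if_neg h, if_neg (Ne.symm h)]
    have := (Matrix.detRowAlternating (R := ℝ) (n := ι)).map_swap
      (Function.update (Function.update M k v) j (H k j)) h
    have h2 : (Function.update (Function.update M k v) j (H k j)) ∘ Equiv.swap k j =
        Function.update (Function.update M j v) k (H j k) := by
      funext l
      by_cases hk : l = k
      · subst hk; simp [hH j l]
      by_cases hj : l = j
      · subst hj; simp [Function.update_of_ne h, Function.update_of_ne hk]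
      · simp [Equiv.swap_apply_of_ne_of_ne hk hj, hk, hj]
    rw [h2] at this
    exact this
  have h2 := Finset.sum_comm (s := (Finset.univ : Finset ι)) (t := (Finset.univ : Finset ι))
    (f := fun j k => (if k = j then 0 else
      (Matrix.of (Function.update (Function.update M j v) k (H j k))).det))
  have h3 : ∑ k, ∑ j, (if k = j then 0 else
      (Matrix.of (Function.update (Function.update M j v) k (H j k))).det) =
      - ∑ k, ∑ j, (if j = k then 0 else
      (Matrix.of (Function.update (Function.update M k v) j (H k j))).det) := by
    rw [← Finset.sum_neg_distrib]
    refine Finset.sum_congr rfl fun k _ => ?_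
    rw [← Finset.sum_neg_distrib]
    exact Finset.sum_congr rfl fun j _ => hanti j k
  linarith

variable {n : ℕ}

/-- The transposed differential matrix of `G`, whose `j`-th row is `∂ⱼG`. -/
noncomputable def gradRows (G : Euc n → Euc n) (x : Euc n) : Fin n → Fin n → ℝ :=
  fun j => (fderiv ℝ G x (EuclideanSpace.single j 1)).ofLp

theorem contDiff_gradRows {G : Euc n → Euc n} (hG : ContDiff ℝ 2 G) :
    ContDiff ℝ 1 (gradRows G) := by
  refine contDiff_pi.2 fun j => ?_
  have h : ContDiff ℝ 1 (fun x => fderiv ℝ G x (EuclideanSpace.single j 1)) :=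
    (hG.fderiv_right (m := 1) (by norm_num)).clm_apply contDiff_const
  exact (PiLp.continuousLinearEquiv 2 ℝ (fun _ : Fin n => ℝ)).contDiff.comp h

theorem fderiv_gradRows_comm {G : Euc n → Euc n} (hG : ContDiff ℝ 2 G) (x : Euc n)
    (j k : Fin n) :
    fderiv ℝ (gradRows G) x (EuclideanSpace.single j 1) k =
      fderiv ℝ (gradRows G) x (EuclideanSpace.single k 1) j := by
  have hd : DifferentiableAt ℝ (fderiv ℝ G) x :=
    ((hG.fderiv_right (m := 1) (by norm_num)).differentiable (by norm_num)) x
  have key : ∀ a b : Fin n, fderiv ℝ (gradRows G) x (EuclideanSpace.single a 1) b =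
      (fderiv ℝ (fderiv ℝ G) x (EuclideanSpace.single a 1) (EuclideanSpace.single b 1)).ofLp := by
    intro a b
    let T : (Euc n →L[ℝ] Euc n) →L[ℝ] (Fin n → ℝ) :=
      (PiLp.continuousLinearEquiv 2 ℝ (fun _ : Fin n => ℝ)).toContinuousLinearMap.comp
        (ContinuousLinearMap.apply ℝ (Euc n) (EuclideanSpace.single b (1 : ℝ)))
    have h1 : HasFDerivAt (fun y => gradRows G y b) (T.comp (fderiv ℝ (fderiv ℝ G) x)) x :=
      T.hasFDerivAt.comp x hd.hasFDerivAt
    have h2 := (hasFDerivAt_pi'.1 (((contDiff_gradRows hG).differentiable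
      (by norm_num)) x).hasFDerivAt b)
    have := DFunLike.congr_fun (h2.unique h1) (EuclideanSpace.single a 1)
    exact this
  rw [key, key]
  have := (hG.contDiffAt (x := x)).isSymmSndFDerivAt (by simp)
  rw [this.eq]

theorem contDiff_det_update {G : Euc n → Euc n} (hG : ContDiff ℝ 2 G)
    {v : Euc n → Fin n → ℝ} (hv : ContDiff ℝ 1 v) (j : Fin n) :
    ContDiff ℝ 1 (fun x => (Matrix.of (Function.update (gradRows G x) j (v x))).det) := by
  simp_rw [Matrix.det_apply]
  refine ContDiff.sum fun σ _ => ContDiff.const_smul _ (contDiff_prod fun i _ => ?_)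
  have h := contDiff_pi.1 (contDiff_gradRows hG) (σ i)
  by_cases hi : σ i = j
  · simpa [Matrix.of_apply, hi] using contDiff_pi.1 hv i
  · simpa [Matrix.of_apply, hi] using contDiff_pi.1 h i

/-- By the product rule the derivative falls either on row `j`, giving the right side, or on another
row, giving the terms that cancel. With `v` constant this says that the cofactor matrix is
divergence free. -/
theorem sum_partialDeriv_det_update {G : Euc n → Euc n} (hG : ContDiff ℝ 2 G)
    {v : Euc n → Fin n → ℝ} (hv : ContDiff ℝ 1 v) (x : Euc n) :
    ∑ j, partialDeriv j (fun x => (Matrix.of (Function.update (gradRows G x) j (v x))).det) x =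
      ∑ j, (Matrix.of (Function.update (gradRows G x) j
        (fderiv ℝ v x (EuclideanSpace.single j 1)))).det := by
  have hM := (((contDiff_gradRows hG).differentiable (by norm_num)) x).hasFDerivAt
  have hv' := ((hv.differentiable (by norm_num)) x).hasFDerivAt
  have key : ∀ j, partialDeriv j
      (fun x => (Matrix.of (Function.update (gradRows G x) j (v x))).det) x =
      (Matrix.of (Function.update (gradRows G x) j
        (fderiv ℝ v x (EuclideanSpace.single j 1)))).det +
      ∑ k, (if k = j then 0 else (Matrix.of (Function.update (Function.update (gradRows G x) j (v x))
        k (fderiv ℝ (gradRows G) x (EuclideanSpace.single j 1) k))).det) := by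
    intro j
    have hR : HasFDerivAt (fun y => Function.update (gradRows G y) j (v y))
        (ContinuousLinearMap.pi (Function.update
          (fun k => (ContinuousLinearMap.proj k).comp (fderiv ℝ (gradRows G) x)) j
            (fderiv ℝ v x))) x := by
      refine hasFDerivAt_pi'.2 fun k => ?_
      by_cases hk : k = j
      · subst hk
        simp only [Function.update_self]
        convert hv' using 1
        ext1 h
        simp
      · simp only [Function.update_of_ne hk]
        convert hasFDerivAt_pi'.1 hM k using 1
        ext1 h
        simp [hk]
    obtain ⟨D, hD, hD'⟩ := hasFDerivAt_det hR
    rw [partialDeriv, hD.fderiv, hD',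
      ← Finset.add_sum_erase _ _ (Finset.mem_univ j)]
    congr 1
    · simp
    · rw [← Finset.sum_subset (Finset.subset_univ (Finset.univ.erase j))]
      · refine Finset.sum_congr rfl fun k hk => ?_
        have : k ≠ j := by simpa using hk
        simp [this]
      · intro k _ hk
        have : k = j := by simpa using hk
        simp [this]
  rw [Finset.sum_congr rfl fun j _ => key j, Finset.sum_add_distrib,
    sum_det_update_update_eq_zero (gradRows G x) (v x)
      (fun j k => fderiv ℝ (gradRows G) x (EuclideanSpace.single j 1) k)
      (fderiv_gradRows_comm hG x), add_zero]

theorem partialDeriv_apply {G : Euc n → Euc n} {x : Euc n} (hG : DifferentiableAt ℝ G x)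
    (i j : Fin n) : partialDeriv j (fun z => G z i) x = gradRows G x j i := by
  have h := (EuclideanSpace.proj (𝕜 := ℝ) i : Euc n →L[ℝ] ℝ).hasFDerivAt.comp x hG.hasFDerivAt
  have h2 : HasFDerivAt (fun z => G z i)
    ((EuclideanSpace.proj (𝕜 := ℝ) i : Euc n →L[ℝ] ℝ).comp (fderiv ℝ G x)) x := h
  rw [partialDeriv, h2.fderiv]
  rfl

/-- With `A`, `B` the transposed differentials of `G` and `V`, the inserted row is row `j` of `A *
B`. By Cramer's rule the sum is the trace of `A * B * adj A`, which cyclicity turns into `det A * tr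
B`. -/
theorem sum_det_update_comp {G V : Euc n → Euc n} {x : Euc n} (hG : DifferentiableAt ℝ G x)
    (hV : DifferentiableAt ℝ V (G x)) :
    ∑ j, (Matrix.of (Function.update (gradRows G x) j
        (fderiv ℝ (fun y => (V (G y)).ofLp) x (EuclideanSpace.single j 1)))).det =
      divergence V (G x) * (Matrix.of (gradRows G x)).det := by
  set A : Matrix (Fin n) (Fin n) ℝ := Matrix.of (gradRows G x) with hA
  set B : Matrix (Fin n) (Fin n) ℝ := Matrix.of (gradRows V (G x)) with hB
  have hrow : ∀ j, fderiv ℝ (fun y => (V (G y)).ofLp) x (EuclideanSpace.single j 1) =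
      (A * B) j := by
    intro j
    have h := (PiLp.continuousLinearEquiv 2 ℝ
      (fun _ : Fin n => ℝ)).toContinuousLinearMap.hasFDerivAt.comp x
      (hV.hasFDerivAt.comp x hG.hasFDerivAt)
    have h2 : fderiv ℝ (fun y => (V (G y)).ofLp) x = _ := h.fderiv
    rw [h2]
    have h3 : fderiv ℝ G x (EuclideanSpace.single j 1) =
        ∑ l, A j l • (EuclideanSpace.single l (1 : ℝ) : Euc n) := by
      ext i
      simp [hA, gradRows, Pi.single_apply]
    funext i
    simp only [ContinuousLinearMap.comp_apply, h3, map_sum, map_smul, Matrix.mul_apply]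
    simp [hB, gradRows]
  have h1 : ∀ j, (Matrix.of (Function.update (gradRows G x) j
        (fderiv ℝ (fun y => (V (G y)).ofLp) x (EuclideanSpace.single j 1)))).det =
      ((A * B) * A.adjugate) j j := by
    intro j
    rw [hrow]
    change (A.updateRow j ((A * B) j)).det = _
    rw [← Matrix.cramer_transpose_apply,
      Matrix.cramer_eq_adjugate_mulVec, ← Matrix.adjugate_transpose, Matrix.mulVec_transpose]
    rfl
  rw [Finset.sum_congr rfl fun j _ => h1 j]
  change Matrix.trace ((A * B) * A.adjugate) = _
  rw [Matrix.trace_mul_comm, ← mul_assoc, Matrix.adjugate_mul, Matrix.smul_mul, one_mul,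
    Matrix.trace_smul, smul_eq_mul, mul_comm]
  congr 1
  exact Finset.sum_congr rfl fun i _ => (partialDeriv_apply hV i i).symm

theorem integral_smooth_piola {G V : Euc n → Euc n} (hG : ContDiff ℝ 2 G) (hV : ContDiff ℝ 1 V)
    {φ : Euc n → ℝ} (hφ : ContDiff ℝ 1 φ) (hc : HasCompactSupport φ) :
    ∫ x, ∑ j, (Matrix.of (Function.update (gradRows G x) j (V (G x)).ofLp)).det *
        partialDeriv j φ x =
      - ∫ x, divergence V (G x) * (Matrix.of (gradRows G x)).det * φ x := by
  have hv : ContDiff ℝ 1 (fun y => (V (G y)).ofLp) :=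
    (PiLp.continuousLinearEquiv 2 ℝ (fun _ : Fin n => ℝ)).contDiff.comp
      (hV.comp (hG.of_le (by norm_num)))
  have hW := fun j => contDiff_det_update hG hv j
  have hdφ : ∀ j, Continuous (fun x => fderiv ℝ φ x (EuclideanSpace.single j 1)) := fun j =>
    (hφ.continuous_fderiv (by norm_num)).clm_apply continuous_const
  have hdφc : ∀ j : Fin n,
      HasCompactSupport (fun x => fderiv ℝ φ x (EuclideanSpace.single j 1)) := fun j =>
    (hc.fderiv (𝕜 := ℝ)).comp_left (g := fun T : Euc n →L[ℝ] ℝ => T (EuclideanSpace.single j 1))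
      (by simp)
  have hdW : ∀ j, Continuous (fun x => fderiv ℝ (fun x => (Matrix.of (Function.update
      (gradRows G x) j (V (G x)).ofLp)).det) x (EuclideanSpace.single j 1)) := fun j =>
    ((hW j).continuous_fderiv (by norm_num)).clm_apply continuous_const
  have i1 : ∀ j, Integrable (fun x => (Matrix.of (Function.update (gradRows G x) j
      (V (G x)).ofLp)).det * fderiv ℝ φ x (EuclideanSpace.single j 1)) := fun j =>
    ((hW j).continuous.mul (hdφ j)).integrable_of_hasCompactSupport (hdφc j).mul_left
  have i2 : ∀ j, Integrable (fun x => fderiv ℝ (fun x => (Matrix.of (Function.update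
      (gradRows G x) j (V (G x)).ofLp)).det) x (EuclideanSpace.single j 1) * φ x) := fun j =>
    ((hdW j).mul hφ.continuous).integrable_of_hasCompactSupport hc.mul_left
  have i3 : ∀ j, Integrable (fun x => (Matrix.of (Function.update (gradRows G x) j
      (V (G x)).ofLp)).det * φ x) := fun j =>
    ((hW j).continuous.mul hφ.continuous).integrable_of_hasCompactSupport hc.mul_left
  have hparts := fun j => integral_mul_fderiv_eq_neg_fderiv_mul_of_integrable (i2 j) (i1 j) (i3 j)
    (fun x _ => ((hW j).differentiable (by norm_num)) x)
    (fun x _ => (hφ.differentiable (by norm_num)) x)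
  simp only [partialDeriv]
  rw [integral_finsetSum _ fun j _ => i1 j, Finset.sum_congr rfl fun j _ => hparts j,
    Finset.sum_neg_distrib, ← integral_finsetSum _ fun j _ => i2 j]
  congr 1
  refine integral_congr_ae (.of_forall fun x => ?_)
  simp only
  rw [← Finset.sum_mul]
  congr 1
  exact (sum_partialDeriv_det_update hG hv x).trans (sum_det_update_comp
    ((hG.differentiable (by norm_num)) x) ((hV.differentiable (by norm_num)) _))

/-! ### Dominated convergence with a varying bound. -/

open Filter Topology Convolution ContinuousLinearMap

/-- Pratt's generalization of the dominated convergence theorem: the bound may vary with the index,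
as long as its integrals converge to the integral of its limit. -/
theorem tendsto_integral_of_tendsto_bound {α : Type*} [MeasurableSpace α] {μ : Measure α}
    {f h : ℕ → α → ℝ} {f' h' : α → ℝ} (hf : ∀ k, AEStronglyMeasurable (f k) μ)
    (hh : ∀ k, Integrable (h k) μ) (hh' : Integrable h' μ)
    (hfh : ∀ k, ∀ᵐ x ∂μ, |f k x| ≤ h k x)
    (hflim : ∀ᵐ x ∂μ, Tendsto (fun k => f k x) atTop (𝓝 (f' x)))
    (hhlim : ∀ᵐ x ∂μ, Tendsto (fun k => h k x) atTop (𝓝 (h' x)))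
    (hlim : Tendsto (fun k => ∫ x, h k x ∂μ) atTop (𝓝 (∫ x, h' x ∂μ))) :
    Tendsto (fun k => ∫ x, f k x ∂μ) atTop (𝓝 (∫ x, f' x ∂μ)) := by
  have hfh' := ae_all_iff.2 hfh
  have hpos : ∀ᵐ x ∂μ, |f' x| ≤ h' x := by
    filter_upwards [hfh', hflim, hhlim] with x h1 h2 h3
    exact le_of_tendsto_of_tendsto' h2.abs h3 h1
  have hfi : ∀ k, Integrable (f k) μ := fun k => (hh k).mono' (hf k) (hfh k)
  -- The bounds converge in `L¹` (Scheffé): `|h k - h'| = (h k - h') + 2 (h' - h k)⁺`, and the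
  -- positive part is dominated by `h'` because `h k ≥ 0`.
  have hdiff : Tendsto (fun k => ∫ x, |h k x - h' x| ∂μ) atTop (𝓝 0) := by
    have h1 : Tendsto (fun k => ∫ x, max (h' x - h k x) 0 ∂μ) atTop (𝓝 (∫ _, (0 : ℝ) ∂μ)) := by
      refine tendsto_integral_of_dominated_convergence h'
        (fun k => ((hh'.sub (hh k)).pos_part).aestronglyMeasurable) hh' (fun k => ?_) ?_
      · filter_upwards [hfh', hpos] with x h1 h2
        have h3 := (abs_nonneg _).trans (h1 k)
        have h4 := (abs_nonneg _).trans h2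
        rw [Real.norm_eq_abs, abs_of_nonneg (le_max_right _ _)]
        exact max_le (by linarith) h4
      · filter_upwards [hhlim] with x hx
        simpa using (tendsto_const_nhds (x := h' x) |>.sub hx).max (tendsto_const_nhds (x := (0 : ℝ)))
    have h2 : Tendsto (fun k => (∫ x, h k x ∂μ) - (∫ x, h' x ∂μ) +
        2 * ∫ x, max (h' x - h k x) 0 ∂μ) atTop (𝓝 0) := by
      simpa using (hlim.sub_const (∫ x, h' x ∂μ)).add (h1.const_mul 2)
    refine h2.congr fun k => ?_
    have hp : Integrable (fun x => 2 * max (h' x - h k x) 0) μ :=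
      ((hh'.sub (hh k)).pos_part).const_mul 2
    have hm : Integrable (fun x => h k x - h' x) μ := (hh k).sub hh'
    rw [← integral_sub (hh k) hh', ← integral_const_mul, ← integral_add hm hp]
    refine integral_congr_ae (.of_forall fun x => ?_)
    simp only
    rcases le_total (h k x) (h' x) with hx | hx
    · rw [max_eq_left (by linarith), abs_of_nonpos (by linarith)]; ring
    · rw [max_eq_right (by linarith), abs_of_nonneg (by linarith)]; ring
  -- Truncating `f k` to `[-h', h']` gives functions dominated by `h'`; the error is at most `|h k -
  -- h'|`.
  have hgm : ∀ k, AEStronglyMeasurable (fun x => max (-h' x) (min (h' x) (f k x))) μ := fun k =>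
    hh'.aestronglyMeasurable.neg.sup (hh'.aestronglyMeasurable.inf (hf k))
  have hgb : ∀ k, ∀ᵐ x ∂μ, ‖max (-h' x) (min (h' x) (f k x))‖ ≤ h' x := by
    intro k
    filter_upwards [hpos] with x hx
    have := (abs_nonneg _).trans hx
    rw [Real.norm_eq_abs, abs_le]
    exact ⟨le_max_left _ _, max_le (by linarith) (min_le_left _ _)⟩
  have hg : Tendsto (fun k => ∫ x, max (-h' x) (min (h' x) (f k x)) ∂μ) atTop
      (𝓝 (∫ x, f' x ∂μ)) := by
    refine tendsto_integral_of_dominated_convergence h' hgm hh' hgb ?_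
    filter_upwards [hflim, hpos] with x h1 h2
    have h3 := (tendsto_const_nhds (x := -h' x)).max ((tendsto_const_nhds (x := h' x)).min h1)
    rwa [min_eq_right (abs_le.1 h2).2, max_eq_right (abs_le.1 h2).1] at h3
  have hgi : ∀ k, Integrable (fun x => max (-h' x) (min (h' x) (f k x))) μ := fun k =>
    hh'.mono' (hgm k) (hgb k)
  have hsub : Tendsto (fun k => ∫ x, f k x - max (-h' x) (min (h' x) (f k x)) ∂μ) atTop
      (𝓝 0) := by
    refine squeeze_zero_norm (fun k => ?_) hdiff
    refine norm_integral_le_of_norm_le ((hh k).sub hh').abs ?_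
    filter_upwards [hfh', hpos] with x h1 h2
    have h3 := abs_le.1 (h1 k)
    have h4 := (abs_nonneg _).trans h2
    have h5 := le_abs_self (h k x - h' x)
    have h6 := abs_nonneg (h k x - h' x)
    rw [Real.norm_eq_abs, abs_le]
    rcases le_total (h' x) (f k x) with h | h
    · rw [min_eq_left h, max_eq_right (by linarith)]
      constructor <;> linarith
    · rw [min_eq_right h]
      rcases le_total (-h' x) (f k x) with h | h
      · rw [max_eq_right h]; constructor <;> linarith
      · rw [max_eq_left h]; constructor <;> linarith
  have := hg.add hsub
  rw [add_zero] at this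
  refine this.congr fun k => ?_
  rw [integral_sub (hfi k) (hgi k)]
  ring

/-! ### Mollification and weak derivatives. -/

section Mollification

variable {X : Type*} [NormedAddCommGroup X] [NormedSpace ℝ X] [FiniteDimensional ℝ X]
  [MeasurableSpace X] [BorelSpace X] {μ : Measure X}
  {E : Type*} [NormedAddCommGroup E] [NormedSpace ℝ E]

theorem convolutionExists_normed
    [μ.IsAddHaarMeasure] (ρ : ContDiffBump (0 : X)) {U : X → E}
    (hU : LocallyIntegrable U μ) :
    ConvolutionExists (ρ.normed μ) U (lsmul ℝ ℝ) μ :=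
  ρ.hasCompactSupport_normed.convolutionExists_left _ ρ.continuous_normed hU

theorem convolution_normed_eq_integral (ρ : ContDiffBump (0 : X)) (W : X → E) (x : X) :
    (ρ.normed μ ⋆[lsmul ℝ ℝ, μ] W) x =
      ∫ t, W (x - t) ∂μ.withDensity fun t => ENNReal.ofReal (ρ.normed μ t) := by
  rw [integral_withDensity_eq_integral_toReal_smul
    ρ.continuous_normed.measurable.ennreal_ofReal (.of_forall fun _ => ENNReal.ofReal_lt_top),
    convolution_def]
  simp [ENNReal.toReal_ofReal, ρ.nonneg_normed]

theorem integrable_withDensity_normed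
    [μ.IsAddHaarMeasure] (ρ : ContDiffBump (0 : X)) {W : X → E}
    (hW : LocallyIntegrable W μ) (x : X) :
    Integrable (fun t => W (x - t)) (μ.withDensity fun t => ENNReal.ofReal (ρ.normed μ t)) := by
  rw [integrable_withDensity_iff_integrable_smul'
    ρ.continuous_normed.measurable.ennreal_ofReal (.of_forall fun _ => ENNReal.ofReal_lt_top)]
  simpa [ENNReal.toReal_ofReal, ρ.nonneg_normed] using (convolutionExists_normed ρ hW x).integrable

/-- Jensen's inequality for the probability measure whose density is the normalized bump. -/
theorem norm_convolution_pow_le [CompleteSpace E]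
    [μ.IsAddHaarMeasure] (ρ : ContDiffBump (0 : X)) {U : X → E} {m : ℕ}
    (hU : LocallyIntegrable U μ) (hUm : LocallyIntegrable (fun x => ‖U x‖ ^ m) μ) (x : X) :
    ‖(ρ.normed μ ⋆[lsmul ℝ ℝ, μ] U) x‖ ^ m ≤
      (ρ.normed μ ⋆[lsmul ℝ ℝ, μ] fun y => ‖U y‖ ^ m) x := by
  have : IsProbabilityMeasure (μ.withDensity fun t => ENNReal.ofReal (ρ.normed μ t)) := by
    refine ⟨?_⟩
    rw [withDensity_apply _ MeasurableSet.univ, Measure.restrict_univ,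
      ← ofReal_integral_eq_lintegral_ofReal ρ.integrable_normed (.of_forall ρ.nonneg_normed),
      ρ.integral_normed, ENNReal.ofReal_one]
  rw [convolution_normed_eq_integral, convolution_normed_eq_integral]
  exact ((convexOn_univ_norm (E := E)).pow (fun _ _ => norm_nonneg _) m).map_integral_le
    (by fun_prop) isClosed_univ (.of_forall fun _ => Set.mem_univ _)
    (integrable_withDensity_normed ρ hU x) (integrable_withDensity_normed ρ hUm x)

end Mollification

/-- The kernel `y ↦ ρ (x - y)` is itself an admissible test function when its support lies in `K`.
The cutoff by `K` is then invisible at `x`. -/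
theorem partialDeriv_convolution {Ω : Opens (Euc n)} {j : Fin n} {u g : Euc n → ℝ}
    (h : IsWeakPartialDeriv Ω j u g) {K : Set (Euc n)} (hK : IsCompact K)
    (hKΩ : K ⊆ (Ω : Set (Euc n))) (ρ : ContDiffBump (0 : Euc n)) {x : Euc n}
    (hx : Metric.closedBall x ρ.rOut ⊆ K) :
    partialDeriv j (ρ.normed volume ⋆[lsmul ℝ ℝ, volume] K.indicator u) x =
      (ρ.normed volume ⋆[lsmul ℝ ℝ, volume] K.indicator g) x := by
  obtain ⟨hu, -, hweak⟩ := h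
  have hρ : ContDiff ℝ (⊤ : ℕ∞) (ρ.normed volume) := ρ.contDiff_normed
  have hui : LocallyIntegrable (K.indicator u) := ((integrable_indicator_iff hK.measurableSet).2
    (hu.integrableOn_compact_subset hKΩ hK)).locallyIntegrable
  have hsupp : tsupport (fun y => ρ.normed volume (x - y)) ⊆ Metric.closedBall x ρ.rOut := by
    refine closure_minimal (fun y hy => ?_) Metric.isClosed_closedBall
    have : x - y ∈ Function.support (ρ.normed volume) := hy
    rw [ρ.support_normed_eq] at this
    rw [Metric.mem_closedBall, dist_comm, dist_eq_norm]
    exact (mem_ball_zero_iff.1 this).le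
  have hzero : ∀ y, y ∉ K → ρ.normed volume (x - y) = 0 := fun y hy =>
    image_eq_zero_of_notMem_tsupport (f := fun y => ρ.normed volume (x - y))
      fun h => hy (hx (hsupp h))
  let ψ : 𝓓(Ω, ℝ) := ⟨fun y => ρ.normed volume (x - y), hρ.comp (contDiff_const.sub contDiff_id),
    HasCompactSupport.of_support_subset_isCompact (isCompact_closedBall x ρ.rOut)
      ((subset_tsupport _).trans hsupp), hsupp.trans (hx.trans hKΩ)⟩
  have hψ : ∀ y, partialDeriv j ψ y =
      - fderiv ℝ (ρ.normed volume) (x - y) (EuclideanSpace.single j 1) := by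
    intro y
    have h1 : HasFDerivAt (ρ.normed volume) (fderiv ℝ (ρ.normed volume) (x - y)) (x - y) :=
      ((hρ.differentiable (by simp)) (x - y)).hasFDerivAt
    have h2 : HasFDerivAt ψ _ y := h1.comp y ((hasFDerivAt_id y).const_sub x)
    rw [partialDeriv, h2.fderiv]
    simp
  have hψK : ∀ y, y ∉ K → partialDeriv j ψ y = 0 := by
    intro y hy
    have : y ∉ tsupport (fderiv ℝ ψ) := fun h' =>
      hy (hx (hsupp (tsupport_fderiv_subset ℝ h')))
    rw [partialDeriv, image_eq_zero_of_notMem_tsupport this]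
    rfl
  have hd := ρ.hasCompactSupport_normed.hasFDerivAt_convolution_left (lsmul ℝ ℝ)
    (hρ.of_le (by simp)) hui x
  have hex := (ρ.hasCompactSupport_normed.fderiv (𝕜 := ℝ)).convolutionExists_left
    ((lsmul ℝ ℝ : ℝ →L[ℝ] ℝ →L[ℝ] ℝ).precompL (Euc n)) (hρ.continuous_fderiv (by simp)) hui x
  rw [partialDeriv, hd.fderiv, convolution_eq_swap,
    ContinuousLinearMap.integral_apply hex.integrable_swap, convolution_eq_swap]
  have e1 : ∀ y, ((lsmul ℝ ℝ : ℝ →L[ℝ] ℝ →L[ℝ] ℝ).precompL (Euc n)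
      (fderiv ℝ (ρ.normed volume) (x - y)) (K.indicator u y)) (EuclideanSpace.single j 1) =
      (Ω : Set (Euc n)).indicator (fun y => - (u y * partialDeriv j ψ y)) y := by
    intro y
    rw [ContinuousLinearMap.precompL_apply]
    by_cases hy : y ∈ K
    · rw [Set.indicator_of_mem hy, Set.indicator_of_mem (hKΩ hy), hψ]
      simp [mul_comm]
    · rw [Set.indicator_of_notMem hy]
      by_cases hy' : y ∈ (Ω : Set (Euc n)) <;> simp [hy', hψK y hy]
  have e2 : ∀ y, (lsmul ℝ ℝ : ℝ →L[ℝ] ℝ →L[ℝ] ℝ) (ρ.normed volume (x - y)) (K.indicator g y) =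
      (Ω : Set (Euc n)).indicator (fun y => g y * ψ y) y := by
    intro y
    by_cases hy : y ∈ K
    · rw [Set.indicator_of_mem hy, Set.indicator_of_mem (hKΩ hy)]
      simp [mul_comm, ψ]
    · rw [Set.indicator_of_notMem hy]
      by_cases hy' : y ∈ (Ω : Set (Euc n)) <;> simp [hy', ψ, hzero y hy]
  simp_rw [e1, e2]
  rw [integral_indicator Ω.isOpen.measurableSet, integral_indicator Ω.isOpen.measurableSet,
    integral_neg, hweak ψ, neg_neg]

/-- The fundamental lemma of the calculus of variations, applied to `g - g'`. It lets the given `DF`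
inherit the integrability of the matrix provided by `MemW1pLoc`. -/
theorem IsWeakPartialDeriv.ae_eq {Ω : Opens (Euc n)} {j : Fin n} {u g g' : Euc n → ℝ}
    (h : IsWeakPartialDeriv Ω j u g) (h' : IsWeakPartialDeriv Ω j u g') :
    g =ᵐ[volume.restrict (Ω : Set (Euc n))] g' := by
  have key := Ω.isOpen.ae_eq_zero_of_integral_contDiff_smul_eq_zero (μ := volume)
    (h.2.1.sub h'.2.1) (fun φ hφ hc hs => ?_)
  · refine (ae_restrict_iff' Ω.isOpen.measurableSet).2 ?_
    filter_upwards [key] with x hx hxΩ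
    exact sub_eq_zero.1 (hx hxΩ)
  · let ψ : 𝓓(Ω, ℝ) := ⟨φ, hφ, hc, hs⟩
    have h1 := (h.2.2 ψ).symm.trans (h'.2.2 ψ)
    have hψ0 : ∀ y, y ∉ (Ω : Set (Euc n)) → φ y = 0 := fun y hy =>
      image_eq_zero_of_notMem_tsupport fun h => hy (hs h)
    have hi : ∀ {w : Euc n → ℝ}, LocallyIntegrableOn w (Ω : Set (Euc n)) →
        Integrable (fun y => φ y • w y) := by
      intro w hw
      have h3 : IntegrableOn (fun y => φ y • w y) (tsupport φ) :=
        (hw.integrableOn_compact_subset hs hc).continuousOn_smul hφ.continuous.continuousOn hc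
      refine (integrableOn_iff_integrable_of_support_subset fun y hy => ?_).1 h3
      exact subset_tsupport φ (left_ne_zero_of_mul hy)
    have h4 : ∀ w : Euc n → ℝ, ∫ y, φ y • w y = ∫ y in (Ω : Set (Euc n)), w y * ψ y := by
      intro w
      rw [← setIntegral_eq_integral_of_forall_compl_eq_zero (s := (Ω : Set (Euc n)))
        fun y hy => by simp [hψ0 y hy]]
      simp [ψ, mul_comm]
    simp only [Pi.sub_apply, smul_sub]
    rw [integral_sub (hi h.2.1) (hi h'.2.1), h4, h4]
    linarith

theorem integrableOn_comp_of_growth {X E : Type*} [MeasurableSpace X] {μ : Measure X}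
    [NormedAddCommGroup E] {Φ : E → ℝ} (hΦ : Continuous Φ) {C : ℝ} {m : ℕ}
    (hC : ∀ p, |Φ p| ≤ C * (1 + ‖p‖ ^ m)) {U : X → E} {K : Set X} (hK : μ K ≠ ∞)
    (hU : AEStronglyMeasurable U (μ.restrict K))
    (hUm : IntegrableOn (fun x => ‖U x‖ ^ m) K μ) : IntegrableOn (fun x => Φ (U x)) K μ :=
  (((integrableOn_const (C := (1 : ℝ)) hK).add hUm).const_mul C).mono'
    (hΦ.comp_aestronglyMeasurable hU) (.of_forall fun x => hC (U x))

theorem integrable_mul_of_integrableOn_tsupport {X : Type*} [TopologicalSpace X] [T2Space X]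
    [MeasurableSpace X] [OpensMeasurableSpace X] {μ : Measure X} {w ψ : X → ℝ} (hψ : Continuous ψ)
    (hψc : HasCompactSupport ψ) (hw : IntegrableOn w (tsupport ψ) μ) :
    Integrable (fun x => w x * ψ x) μ := by
  have h : IntegrableOn (fun x => w x * ψ x) (tsupport ψ) μ :=
    hw.mul_continuousOn hψ.continuousOn hψc
  exact (integrableOn_iff_integrable_of_support_subset fun y hy =>
    subset_tsupport ψ (right_ne_zero_of_mul hy)).1 h

/-! ### Limits of integrands of polynomial growth. -/

section GrowthLimit

variable {X : Type*} [NormedAddCommGroup X] [NormedSpace ℝ X] [FiniteDimensional ℝ X]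
  [MeasurableSpace X] [BorelSpace X] {μ : Measure X}
  {E : Type*} [NormedAddCommGroup E]

theorem tendsto_integral_comp_convolution [μ.IsAddHaarMeasure] [NormedSpace ℝ E]
    [CompleteSpace E] {Φ : E → ℝ} (hΦ : Continuous Φ) {C : ℝ} {m : ℕ}
    (hC : ∀ p, |Φ p| ≤ C * (1 + ‖p‖ ^ m)) {U : X → E} (hU : LocallyIntegrable U μ)
    (hUm : Integrable (fun x => ‖U x‖ ^ m) μ) {ψ : X → ℝ} (hψ : Continuous ψ)
    (hψc : HasCompactSupport ψ) {ρ : ℕ → ContDiffBump (0 : X)}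
    (hρ : Tendsto (fun k => (ρ k).rOut) atTop (𝓝 0)) {a : ℝ}
    (hρa : ∀ k, (ρ k).rOut ≤ a * (ρ k).rIn) :
    Tendsto (fun k => ∫ x, Φ (((ρ k).normed μ ⋆[lsmul ℝ ℝ, μ] U) x) * ψ x ∂μ) atTop
      (𝓝 (∫ x, Φ (U x) * ψ x ∂μ)) := by
  obtain ⟨B, hB⟩ := hψ.bounded_above_of_compact_support hψc
  have hB0 : 0 ≤ B := (norm_nonneg _).trans (hB 0)
  have hC0 : 0 ≤ C := by
    have h := (abs_nonneg _).trans (hC 0)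
    by_contra! hneg
    have : (0 : ℝ) < 1 + ‖(0 : E)‖ ^ m := by positivity
    nlinarith
  have hK : IntegrableOn (fun _ => (1 : ℝ)) (tsupport ψ) μ :=
    integrableOn_const hψc.measure_lt_top.ne
  have hKi : Integrable ((tsupport ψ).indicator fun _ => (1 : ℝ)) μ :=
    (integrable_indicator_iff (isClosed_tsupport ψ).measurableSet).2 hK
  have hconv : ∀ k, Integrable
      ((ρ k).normed μ ⋆[lsmul ℝ ℝ, μ] fun x => ‖U x‖ ^ m) μ := fun k =>
    Integrable.integrable_convolution _ (ρ k).integrable_normed hUm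
  have hconv_int : ∀ k, ∫ x, ((ρ k).normed μ ⋆[lsmul ℝ ℝ, μ] fun x => ‖U x‖ ^ m) x ∂μ =
      ∫ x, ‖U x‖ ^ m ∂μ := by
    intro k
    rw [integral_convolution (μ := μ) (ν := μ) _ (ρ k).integrable_normed hUm,
      (ρ k).integral_normed]
    simp
  have hae := ContDiffBump.ae_convolution_tendsto_right_of_locallyIntegrable (μ := μ) hρ
    (.of_forall hρa) hU
  have haem := ContDiffBump.ae_convolution_tendsto_right_of_locallyIntegrable (μ := μ) hρ
    (.of_forall hρa) hUm.locallyIntegrable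
  -- The bound combines the growth of `Φ`, the supremum `B` of `|ψ|` and Jensen. The constant term
  -- needs the indicator of the support to be integrable.
  refine tendsto_integral_of_tendsto_bound
    (h := fun k x => C * B * ((tsupport ψ).indicator (fun _ => (1 : ℝ)) x +
      ((ρ k).normed μ ⋆[lsmul ℝ ℝ, μ] fun x => ‖U x‖ ^ m) x))
    (h' := fun x => C * B * ((tsupport ψ).indicator (fun _ => (1 : ℝ)) x + ‖U x‖ ^ m))
    (fun k => ?_) (fun k => (hKi.add (hconv k)).const_mul _) ((hKi.add hUm).const_mul _)
    (fun k => .of_forall fun x => ?_) ?_ ?_ ?_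
  · have hc := ((ρ k).hasCompactSupport_normed (μ := μ)).continuous_convolution_left (lsmul ℝ ℝ)
      (ρ k).continuous_normed hU
    exact ((hΦ.comp hc).mul hψ).aestronglyMeasurable
  · have hJ := norm_convolution_pow_le (ρ k) hU hUm.locallyIntegrable x
    have hp := (pow_nonneg (norm_nonneg (((ρ k).normed μ ⋆[lsmul ℝ ℝ, μ] U) x)) m).trans hJ
    by_cases hx : x ∈ tsupport ψ
    · rw [Set.indicator_of_mem hx, abs_mul]
      calc |Φ (((ρ k).normed μ ⋆[lsmul ℝ ℝ, μ] U) x)| * |ψ x|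
          ≤ (C * (1 + ‖((ρ k).normed μ ⋆[lsmul ℝ ℝ, μ] U) x‖ ^ m)) * B :=
            mul_le_mul (hC _) (hB x) (abs_nonneg _) (by positivity)
        _ ≤ (C * (1 + ((ρ k).normed μ ⋆[lsmul ℝ ℝ, μ] fun x => ‖U x‖ ^ m) x)) * B := by gcongr
        _ = _ := by ring
    · rw [image_eq_zero_of_notMem_tsupport hx, mul_zero, abs_zero, Set.indicator_of_notMem hx,
        zero_add]
      positivity
  · filter_upwards [hae] with x hx
    exact ((hΦ.tendsto _).comp hx).mul_const _
  · filter_upwards [haem] with x hx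
    exact (tendsto_const_nhds.add hx).const_mul _
  -- Convolution with a kernel of mass one preserves the integral, so the bounds have constant
  -- integral.
  · refine tendsto_const_nhds.congr fun k => ?_
    rw [integral_const_mul, integral_const_mul, integral_add hKi hUm, integral_add hKi (hconv k),
      hconv_int k]

end GrowthLimit

/-! ### Jets and the growth of the two integrands. -/

/-- The values of a map `ℝⁿ → ℝⁿ` and of its transposed differential matrix at a point. -/
abbrev Jet (n : ℕ) : Type := (Fin n → ℝ) × (Fin n → Fin n → ℝ)

/-- The `j`-th component of `adj(A) V(y)` at the jet `(y, Aᵀ)`. -/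
noncomputable def flux (V : Euc n → Euc n) (j : Fin n) (p : Jet n) : ℝ :=
  (Matrix.of (Function.update p.2 j (V (WithLp.toLp 2 p.1)).ofLp)).det

/-- The quantity `div V(y) det A` at the jet `(y, Aᵀ)`. -/
noncomputable def fluxDiv (V : Euc n → Euc n) (p : Jet n) : ℝ :=
  divergence V (WithLp.toLp 2 p.1) * (Matrix.of p.2).det

theorem abs_det_le {A : Matrix (Fin n) (Fin n) ℝ} {x : ℝ} (h : ∀ i j, |A i j| ≤ x) :
    |A.det| ≤ n.factorial * x ^ n := by
  simpa using Matrix.det_le (abv := AbsoluteValue.abs) h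

theorem divergence_eq_sum {V : Euc n → Euc n} (hV : Differentiable ℝ V) (y : Euc n) :
    divergence V y = ∑ i, fderiv ℝ V y (EuclideanSpace.single i 1) i :=
  Finset.sum_congr rfl fun i _ => partialDeriv_apply (hV y) i i

theorem continuous_flux {V : Euc n → Euc n} (hV : Continuous V) (j : Fin n) :
    Continuous (flux V j) := by
  have h1 : Continuous fun p : Jet n => (V (WithLp.toLp 2 p.1)).ofLp := by fun_prop
  exact (continuous_snd.update j h1).matrix_det

theorem continuous_fluxDiv {V : Euc n → Euc n} (hV : ContDiff ℝ 1 V) :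
    Continuous (fluxDiv V) := by
  have h1 : Continuous (divergence V) := by
    rw [show divergence V = _ from funext (divergence_eq_sum (hV.differentiable (by norm_num)))]
    have := hV.continuous_fderiv (by norm_num)
    fun_prop
  have h2 : Continuous fun p : Jet n => (Matrix.of p.2).det := continuous_snd.matrix_det
  exact (h1.comp (by fun_prop)).mul h2

/-- The mean value inequality bounds `V` linearly, so every entry of the matrix is at most linear in
`‖p‖` and the determinant has degree `n`. -/
theorem abs_flux_le {V : Euc n → Euc n} (hV : Differentiable ℝ V) {C : ℝ}
    (hC : ∀ y, ‖fderiv ℝ V y‖ ≤ C) :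
    ∃ C', ∀ (j : Fin n) (p : Jet n), |flux V j p| ≤ C' * (1 + ‖p‖ ^ n) := by
  have hC0 : 0 ≤ C := (norm_nonneg _).trans (hC 0)
  set T := PiLp.continuousLinearEquiv 2 ℝ (fun _ : Fin n => ℝ)
  set S := ‖(T.symm : (Fin n → ℝ) →L[ℝ] Euc n)‖ with hS
  -- `S` compares the Euclidean norm with the sup norm on jets; the summand `1` makes `D` dominate
  -- the unreplaced rows too.
  set D := 1 + ‖V 0‖ + C * S with hD
  have hS0 : 0 ≤ S := norm_nonneg _
  have hCS : 0 ≤ C * S := mul_nonneg hC0 hS0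
  have hD1 : 1 ≤ D := by have := norm_nonneg (V 0); linarith
  have hVb : ∀ p : Jet n, ‖V (WithLp.toLp 2 p.1)‖ ≤ D * (1 + ‖p‖) := by
    intro p
    have h1 := convex_univ.norm_image_sub_le_of_norm_fderiv_le (fun x _ => hV x) (fun x _ => hC x)
      (Set.mem_univ 0) (Set.mem_univ (WithLp.toLp 2 p.1))
    have h2 : ‖(WithLp.toLp 2 p.1 : Euc n)‖ ≤ S * ‖p.1‖ :=
      (T.symm : (Fin n → ℝ) →L[ℝ] Euc n).le_opNorm p.1
    have h3 := norm_fst_le p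
    have h4 := norm_le_norm_add_norm_sub' (V (WithLp.toLp 2 p.1)) (V 0)
    rw [sub_zero] at h1
    calc ‖V (WithLp.toLp 2 p.1)‖ ≤ ‖V 0‖ + C * (S * ‖p‖) := by
          refine h4.trans (by gcongr; exact h1.trans (by gcongr; exact h2.trans (by gcongr)))
      _ ≤ D * (1 + ‖p‖) := by
          have := norm_nonneg (V 0)
          have := norm_nonneg p
          rw [hD]
          nlinarith [mul_nonneg (norm_nonneg (V 0)) (norm_nonneg p)]
  refine ⟨n.factorial * (D ^ n * 2 ^ (n - 1)), fun j p => ?_⟩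
  have hentry : ∀ i l, |Matrix.of (Function.update p.2 j (V (WithLp.toLp 2 p.1)).ofLp) i l| ≤
      D * (1 + ‖p‖) := by
    intro i l
    rw [Matrix.of_apply]
    by_cases hi : i = j
    · subst hi
      rw [Function.update_self]
      exact (PiLp.norm_apply_le _ l).trans (hVb p)
    · rw [Function.update_of_ne hi]
      have h1 : |p.2 i l| ≤ ‖p‖ :=
        ((norm_le_pi_norm (p.2 i) l).trans (norm_le_pi_norm p.2 i)).trans (norm_snd_le p)
      nlinarith [norm_nonneg p]
  calc |flux V j p| ≤ n.factorial * (D * (1 + ‖p‖)) ^ n := abs_det_le hentry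
    _ ≤ n.factorial * (D ^ n * (2 ^ (n - 1) * (1 ^ n + ‖p‖ ^ n))) := by
        rw [mul_pow]
        gcongr
        exact add_pow_le zero_le_one (norm_nonneg p) n
    _ = _ := by rw [one_pow]; ring

theorem abs_fluxDiv_le {V : Euc n → Euc n} (hV : Differentiable ℝ V) {C : ℝ}
    (hC : ∀ y, ‖fderiv ℝ V y‖ ≤ C) :
    ∃ C', ∀ p : Jet n, |fluxDiv V p| ≤ C' * (1 + ‖p‖ ^ n) := by
  have hC0 : 0 ≤ C := (norm_nonneg _).trans (hC 0)
  have hdiv : ∀ y, |divergence V y| ≤ n * C := by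
    intro y
    rw [divergence_eq_sum hV]
    refine (Finset.abs_sum_le_sum_abs _ _).trans ((Finset.sum_le_card_nsmul _ _ C ?_).trans ?_)
    · intro i _
      refine (PiLp.norm_apply_le _ i).trans (((fderiv ℝ V y).le_opNorm _).trans ?_)
      simpa using hC y
    · simp
  refine ⟨n * C * n.factorial, fun p => ?_⟩
  have hdet : |(Matrix.of p.2).det| ≤ n.factorial * ‖p‖ ^ n := abs_det_le fun i l =>
    ((norm_le_pi_norm (p.2 i) l).trans (norm_le_pi_norm p.2 i)).trans (norm_snd_le p)
  calc |fluxDiv V p| = |divergence V (WithLp.toLp 2 p.1)| * |(Matrix.of p.2).det| := abs_mul _ _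
    _ ≤ (n * C) * (n.factorial * ‖p‖ ^ n) :=
        mul_le_mul (hdiv _) hdet (abs_nonneg _) (by positivity)
    _ ≤ (n * C) * (n.factorial * (1 + ‖p‖ ^ n)) := by gcongr; linarith
    _ = _ := by ring

/-- The jet of a map `F` with differential matrix `DF`. -/
def jet (F : Euc n → Euc n) (DF : Euc n → Matrix (Fin n) (Fin n) ℝ) (x : Euc n) : Jet n :=
  ((F x).ofLp, fun j i => DF x i j)

theorem flux_jet (V F : Euc n → Euc n) (DF : Euc n → Matrix (Fin n) (Fin n) ℝ) (j : Fin n)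
    (x : Euc n) : flux V j (jet F DF x) = (DF x).adjugate.mulVec (V (F x)).ofLp j := by
  rw [← Matrix.cramer_eq_adjugate_mulVec, ← (DF x).transpose_transpose,
    Matrix.cramer_transpose_apply]
  rfl

theorem fluxDiv_jet (V F : Euc n → Euc n) (DF : Euc n → Matrix (Fin n) (Fin n) ℝ)
    (x : Euc n) : fluxDiv V (jet F DF x) = divergence V (F x) * (DF x).det := by
  rw [← Matrix.det_transpose]
  rfl

theorem memLp_jet {p : ℝ≥0∞} {μ : Measure (Euc n)} {F : Euc n → Euc n}
    {DF : Euc n → Matrix (Fin n) (Fin n) ℝ} (hF : MemLp F p μ)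
    (hDF : ∀ i j, MemLp (fun x => DF x i j) p μ) : MemLp (jet F DF) p μ :=
  memLp_prod_iff.2 ⟨memLp_pi_iff.2 fun i => memLp_piLp_iff.1 hF i,
    memLp_pi_iff.2 fun j => memLp_pi_iff.2 fun i => hDF i j⟩

theorem memLpLoc_of_isWeakJacobian {Ω : Opens (Euc n)} {p : ℝ≥0∞} {F : Euc n → Euc n}
    (hF : MemW1pLoc Ω p F) {DF : Euc n → Matrix (Fin n) (Fin n) ℝ} (hDF : IsWeakJacobian Ω F DF)
    (i j : Fin n) : MemLpLoc Ω p (fun x => DF x i j) := by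
  obtain ⟨-, DF', hDF', hp⟩ := hF
  intro K hK hKΩ
  exact (hp i j K hK hKΩ).ae_eq
    (ae_restrict_of_ae_restrict_of_subset hKΩ ((hDF' i j).ae_eq (hDF i j)))

/-! ### The mollified identity and passage to the limit. -/

/-- The Piola identity for the mollification of `F` at a scale that keeps the support of the test
function at a positive distance from the complement of `K`. -/
theorem integral_mollified_piola {Ω : Opens (Euc n)} {F : Euc n → Euc n}
    {DF : Euc n → Matrix (Fin n) (Fin n) ℝ} (hDF : IsWeakJacobian Ω F DF)
    {V : Euc n → Euc n} (hV : ContDiff ℝ 1 V) {K : Set (Euc n)} (hK : IsCompact K)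
    (hKΩ : K ⊆ (Ω : Set (Euc n))) (hU : IntegrableOn (jet F DF) K) {φ : Euc n → ℝ}
    (hφ : ContDiff ℝ 1 φ) (hc : HasCompactSupport φ) (ρ : ContDiffBump (0 : Euc n))
    (hρ : ∀ x ∈ tsupport φ, Metric.closedBall x ρ.rOut ⊆ K) :
    ∫ x, ∑ j, flux V j ((ρ.normed volume ⋆[lsmul ℝ ℝ, volume] K.indicator (jet F DF)) x) *
        partialDeriv j φ x =
      - ∫ x, fluxDiv V ((ρ.normed volume ⋆[lsmul ℝ ℝ, volume] K.indicator (jet F DF)) x) * φ x := by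
  set U := K.indicator (jet F DF) with hUdef
  have hUi : LocallyIntegrable U :=
    ((integrable_indicator_iff hK.measurableSet).2 hU).locallyIntegrable
  set W := ρ.normed volume ⋆[lsmul ℝ ℝ, volume] U with hW
  -- Linear functionals commute with convolution, so the mollified jet can be read entry by entry.
  have hproj : ∀ (T : Jet n →L[ℝ] ℝ) (x : Euc n), T (W x) =
      (ρ.normed volume ⋆[lsmul ℝ ℝ, volume] K.indicator fun y => T (jet F DF y)) x := by
    intro T x
    rw [hW, convolution_def, ← T.integral_comp_comm (convolutionExists_normed ρ hUi x).integrable,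
      convolution_def]
    refine integral_congr_ae (.of_forall fun t => ?_)
    by_cases ht : x - t ∈ K <;> simp [hUdef, ht]
  have hWc : ContDiff ℝ 2 W :=
    ρ.hasCompactSupport_normed.contDiff_convolution_left _ (ρ.contDiff_normed (n := 2)) hUi
  set G : Euc n → Euc n := fun x => WithLp.toLp 2 (W x).1 with hG
  have hGc : ContDiff ℝ 2 G :=
    (PiLp.continuousLinearEquiv 2 ℝ (fun _ : Fin n => ℝ)).symm.contDiff.comp
      (contDiff_fst.comp hWc)
  -- Only on the support of `φ` is the mollified jet the jet of `G`: near the boundary of `K` the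
  -- cutoff may spoil this, but `φ` vanishes there.
  have hgrad : ∀ x ∈ tsupport φ, gradRows G x = (W x).2 := by
    intro x hx
    funext j i
    rw [← partialDeriv_apply ((hGc.differentiable (by norm_num)) x)]
    have h1 : (fun z => G z i) =
        ρ.normed volume ⋆[lsmul ℝ ℝ, volume] K.indicator fun y => F y i :=
      funext (hproj ((ContinuousLinearMap.proj i).comp (ContinuousLinearMap.fst ℝ _ _)))
    have h2 : (W x).2 j i =
        (ρ.normed volume ⋆[lsmul ℝ ℝ, volume] K.indicator fun y => DF y i j) x :=
      hproj (((ContinuousLinearMap.proj i).comp (ContinuousLinearMap.proj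
        (R := ℝ) (φ := fun _ : Fin n => Fin n → ℝ) j)).comp (ContinuousLinearMap.snd ℝ _ _)) x
    rw [h1, h2]
    exact partialDeriv_convolution (hDF i j) hK hKΩ ρ (hρ x hx)
  have hdφ : ∀ j : Fin n, ∀ x ∉ tsupport φ, partialDeriv j φ x = 0 := by
    intro j x hx
    rw [partialDeriv,
      image_eq_zero_of_notMem_tsupport fun h => hx (tsupport_fderiv_subset ℝ h)]
    rfl
  have key := integral_smooth_piola hGc hV hφ hc
  convert key using 2
  · funext x
    by_cases hx : x ∈ tsupport φ
    · rw [hgrad x hx]; rfl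
    · simp [hdφ _ x hx]
  · congr 1
    funext x
    by_cases hx : x ∈ tsupport φ
    · rw [hgrad x hx]; rfl
    · simp [image_eq_zero_of_notMem_tsupport hx]

theorem distribDivEq_adjugate_mulVec_comp (hn : n ≠ 0) {Ω : Opens (Euc n)} {F : Euc n → Euc n}
    (hF : MemW1pLoc Ω (n : ENNReal) F) {DF : Euc n → Matrix (Fin n) (Fin n) ℝ}
    (hDF : IsWeakJacobian Ω F DF) {V : Euc n → Euc n} (hV : ContDiff ℝ 1 V) {C : ℝ}
    (hC : ∀ y, ‖fderiv ℝ V y‖ ≤ C) :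
    DistribDivEq Ω (fun x => WithLp.toLp 2 ((DF x).adjugate.mulVec (V (F x)).ofLp))
      (fun x => divergence V (F x) * (DF x).det) := by
  have hVd : Differentiable ℝ V := hV.differentiable (by norm_num)
  obtain ⟨C₁, hC₁⟩ := abs_flux_le hVd hC
  obtain ⟨C₂, hC₂⟩ := abs_fluxDiv_le hVd hC
  have hmem : ∀ K : Set (Euc n), IsCompact K → K ⊆ (Ω : Set (Euc n)) →
      MemLp (jet F DF) (n : ENNReal) (volume.restrict K) := fun K hK hKΩ =>
    memLp_jet (hF.1 K hK hKΩ) fun i j => memLpLoc_of_isWeakJacobian hF hDF i j K hK hKΩ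
  have hflux : ∀ j (K : Set (Euc n)), IsCompact K → K ⊆ (Ω : Set (Euc n)) →
      IntegrableOn (fun x => flux V j (jet F DF x)) K := fun j K hK hKΩ =>
    integrableOn_comp_of_growth (continuous_flux hV.continuous j) (hC₁ j) hK.measure_lt_top.ne
      (hmem K hK hKΩ).aestronglyMeasurable ((hmem K hK hKΩ).integrable_norm_pow hn)
  have hdiv : ∀ (K : Set (Euc n)), IsCompact K → K ⊆ (Ω : Set (Euc n)) →
      IntegrableOn (fun x => fluxDiv V (jet F DF x)) K := fun K hK hKΩ =>
    integrableOn_comp_of_growth (continuous_fluxDiv hV) hC₂ hK.measure_lt_top.ne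
      (hmem K hK hKΩ).aestronglyMeasurable ((hmem K hK hKΩ).integrable_norm_pow hn)
  simp_rw [← fluxDiv_jet V F DF]
  refine ⟨?_, ?_, fun φ => ?_⟩
  · refine (locallyIntegrableOn_iff Ω.isOpen.isLocallyClosed).2 fun K hKΩ hK => ?_
    refine integrable_piLp_iff.2 fun j => ?_
    simpa only [← flux_jet, IntegrableOn] using hflux j K hK hKΩ
  · exact (locallyIntegrableOn_iff Ω.isOpen.isLocallyClosed).2 fun K hKΩ hK => hdiv K hK hKΩ
  simp only [← flux_jet]
  -- The closed `δ`-neighbourhood of the support is a compact subset of `Ω` with room for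
  -- mollification at every scale up to `δ`.
  obtain ⟨δ, hδ, hδΩ⟩ := φ.hasCompactSupport.exists_cthickening_subset_open Ω.isOpen
    φ.tsupport_subset
  set K := Metric.cthickening δ (tsupport φ) with hKdef
  have hK : IsCompact K := φ.hasCompactSupport.isCompact.cthickening
  have hφK : tsupport φ ⊆ K := Metric.self_subset_cthickening _
  have : IsFiniteMeasure ((volume : Measure (Euc n)).restrict K) :=
    ⟨by simpa using hK.measure_lt_top⟩
  have hUi : IntegrableOn (jet F DF) K :=
    (hmem K hK hδΩ).integrable (by exact_mod_cast Nat.one_le_iff_ne_zero.2 hn)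
  set U := K.indicator (jet F DF) with hU
  have hUloc : LocallyIntegrable U :=
    ((integrable_indicator_iff hK.measurableSet).2 hUi).locallyIntegrable
  have hUn : Integrable fun x => ‖U x‖ ^ n := by
    have h := (integrable_indicator_iff hK.measurableSet).2
      ((hmem K hK hδΩ).integrable_norm_pow hn)
    refine h.congr (.of_forall fun x => ?_)
    by_cases hx : x ∈ K <;> simp [hU, hx, hn]
  have hφ1 : ContDiff ℝ 1 φ := φ.contDiff.of_le (by simp)
  have hdφ : ∀ j : Fin n, Continuous (partialDeriv j φ) := fun j =>
    (hφ1.continuous_fderiv (by norm_num)).clm_apply continuous_const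
  have hdφc : ∀ j : Fin n, HasCompactSupport (partialDeriv j φ) := fun j =>
    (φ.hasCompactSupport.fderiv (𝕜 := ℝ)).comp_left
      (g := fun T : Euc n →L[ℝ] ℝ => T (EuclideanSpace.single j 1)) (by simp)
  have hdφs : ∀ j : Fin n, tsupport (partialDeriv j φ) ⊆ tsupport φ := fun j =>
    (closure_mono (Function.support_comp_subset
      (g := fun T : Euc n →L[ℝ] ℝ => T (EuclideanSpace.single j 1)) (by simp) (fderiv ℝ φ))).trans
      (tsupport_fderiv_subset ℝ)
  -- The fixed ratio `2` of the radii is what almost everywhere convergence of the mollifications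
  -- asks for.
  let ρ : ℕ → ContDiffBump (0 : Euc n) := fun k =>
    ⟨δ / (k + 1) / 2, δ / (k + 1), by positivity, half_lt_self (by positivity)⟩
  have hρ0 : Tendsto (fun k => (ρ k).rOut) atTop (𝓝 0) := by
    simpa [ρ, div_eq_mul_inv] using (tendsto_one_div_add_atTop_nhds_zero_nat (𝕜 := ℝ)).const_mul δ
  have hρ2 : ∀ k, (ρ k).rOut ≤ 2 * (ρ k).rIn := fun k => by simp only [ρ]; linarith
  have hρK : ∀ k, ∀ x ∈ tsupport φ, Metric.closedBall x (ρ k).rOut ⊆ K := by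
    intro k x hx
    refine (Metric.closedBall_subset_cthickening hx _).trans (Metric.cthickening_mono ?_ _)
    exact div_le_self hδ.le (by linarith [k.cast_nonneg (α := ℝ)])
  have hmoll := fun k => integral_mollified_piola hDF hV hK hδΩ hUi hφ1 φ.hasCompactSupport (ρ k)
    (hρK k)
  have hlim2 := tendsto_integral_comp_convolution (continuous_fluxDiv hV) hC₂ hUloc hUn
    φ.continuous φ.hasCompactSupport hρ0 hρ2
  have hlim1 := tendsto_finsetSum Finset.univ fun (j : Fin n) _ =>
    tendsto_integral_comp_convolution (continuous_flux hV.continuous j) (hC₁ j) hUloc hUn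
      (hdφ j) (hdφc j) hρ0 hρ2
  have hUflux : ∀ j, ∀ x, flux V j (U x) * partialDeriv j φ x =
      flux V j (jet F DF x) * partialDeriv j φ x := by
    intro j x
    by_cases hx : x ∈ K
    · rw [hU, Set.indicator_of_mem hx]
    · rw [image_eq_zero_of_notMem_tsupport fun h => hx (hφK (hdφs j h)), mul_zero, mul_zero]
  have hUdiv : ∀ x, fluxDiv V (U x) * φ x = fluxDiv V (jet F DF x) * φ x := by
    intro x
    by_cases hx : x ∈ K
    · rw [hU, Set.indicator_of_mem hx]
    · rw [image_eq_zero_of_notMem_tsupport fun h => hx (hφK h), mul_zero, mul_zero]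
  have hsum : ∀ k, ∑ j, ∫ x, flux V j (((ρ k).normed volume ⋆[lsmul ℝ ℝ,
      volume] U) x) * partialDeriv j φ x = - ∫ x, fluxDiv V (((ρ k).normed volume
        ⋆[lsmul ℝ ℝ, volume] U) x) * φ x := by
    intro k
    rw [← hmoll k, integral_finsetSum]
    intro j _
    have hc := ((ρ k).hasCompactSupport_normed (μ := volume)).continuous_convolution_left
      (lsmul ℝ ℝ) (ρ k).continuous_normed hUloc
    exact (((continuous_flux hV.continuous j).comp hc).mul
      (hdφ j)).integrable_of_hasCompactSupport (hdφc j).mul_left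
  have hfinal := tendsto_nhds_unique (hlim1.congr hsum) hlim2.neg
  simp only [hUflux, hUdiv] at hfinal
  have hzero : ∀ x ∉ (Ω : Set (Euc n)), x ∉ tsupport φ := fun x hx h => hx (φ.tsupport_subset h)
  rw [setIntegral_eq_integral_of_forall_compl_eq_zero fun x hx => ?_,
    setIntegral_eq_integral_of_forall_compl_eq_zero fun x hx => ?_, integral_finsetSum]
  · exact hfinal
  · exact fun j _ => integrable_mul_of_integrableOn_tsupport (hdφ j) (hdφc j)
      (hflux j _ (hdφc j) ((hdφs j).trans φ.tsupport_subset))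
  · rw [image_eq_zero_of_notMem_tsupport (hzero x hx), mul_zero]
  · exact Finset.sum_eq_zero fun j _ => by
      rw [image_eq_zero_of_notMem_tsupport fun h => hzero x hx (hdφs j h), mul_zero]

end Piola

theorem theorem2p1 (n : ℕ) (hn : 2 ≤ n) (Ω : TopologicalSpace.Opens (Piola.Euc n))
    (F : Piola.Euc n → Piola.Euc n) (hF : Piola.MemW1pLoc Ω (n : ENNReal) F)
    (DF : Piola.Euc n → Matrix (Fin n) (Fin n) ℝ) (hDF : Piola.IsWeakJacobian Ω F DF)
    (V : Piola.Euc n → Piola.Euc n) (hV : ContDiff ℝ 1 V)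
    (hV' : ∃ C : ℝ, ∀ y, ‖fderiv ℝ V y‖ ≤ C) :
    Piola.DistribDivEq Ω
      (fun x => WithLp.toLp 2 ((DF x).adjugate.mulVec (V (F x)).ofLp))
      (fun x => Piola.divergence V (F x) * (DF x).det) := by
  obtain ⟨C, hC⟩ := hV'
  exact Piola.distribDivEq_adjugate_mulVec_comp (by omega) hF hDF hV hC
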